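/- Let $D\ge 0$ and $q\ge 2$ be integers and let $X=\{0,1,\dots,q-1\}^D$ be the vertex set of the Hamming scheme $\mathrm{H}(D,q)$. For $0\le i\le D$ let $A_i$ be the matrix, with rows and columns indexed by $X$, whose $(x,y)$-entry is $1$ if $x$ and $y$ differ in exactly $i$ coordinates and $0$ otherwise. For $0\le j\le D$ let $E_j$ be the $j$-th primitive idempotent of the Bose–Mesner algebra $\langle A_0,\dots,A_D\rangle$ in the standard ordering, i.e. the orthogonal projection of $\mathbb{C}^X$ onto the eigenspace of $A_1$ for the eigenvalue $(q-1)D-qj$. A code is a subset $Y\subseteq X$ with $1<|Y|<|X|$. Let $\chi=\chi_Y\in\mathbb{C}^X$ be its characteristic vector, and let $$\delta=\min\{i\neq 0:\langle\chi,A_i\chi\rangle\neq 0\},\qquad \delta^*=\min\{j\neq 0:E_j\chi\neq 0\},\qquad s^*=|\{j\neq 0:E_j\chi\neq 0\}|$$ be its minimum distance, dual distance and dual degree. For every code $Y$ in $\mathrm{H}(D,q)$, $$\delta\le\delta^*+s^*-1$$ unless $Y$ is a binary repetition code, that is, unless $q=2$ and $Y=\{x,y\}$ for two words $x,y$ that differ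 in every coordinate. Moreover, if $q=2$ and the code $Y$ is a bipartite half of $\mathrm{H}(D,2)$, that is, the set of all words at even distance from some fixed word, then $\delta=2$, $s^*=1$ and $\delta^*=D$. -/

import Mathlib

namespace HammingScheme

/-- The associate matrix `A_i` of the Hamming scheme `H(D,q)`: its `(x,y)`-entry is `1` if the
words `x` and `y` differ in exactly `i` coordinates and `0` otherwise. -/
noncomputable def assocMatrix (D q i : ℕ) : Matrix (Fin D → Fin q) (Fin D → Fin q) ℂ :=
  Matrix.of fun x y => if hammingDist x y = i then 1 else 0

/-- The standard module `V = ℂ^X`, `X = Fin D → Fin q`, with its Hermitian inner product. -/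
abbrev StdModule (D q : ℕ) : Type := EuclideanSpace ℂ (Fin D → Fin q)

/-- The action of `A_i` on the standard module. -/
noncomputable def assocMap (D q i : ℕ) : StdModule D q →ₗ[ℂ] StdModule D q :=
  Matrix.toEuclideanLin (assocMatrix D q i)

/-- The `j`-th eigenvalue `θ_j = (q - 1) D - q j` of `A_1` (`0 ≤ j ≤ D`), in the standard
(decreasing) ordering. -/
noncomputable def eigenvalue (D q j : ℕ) : ℂ :=
  ((q : ℂ) - 1) * (D : ℂ) - (q : ℂ) * (j : ℂ)

/-- The `j`-th primitive idempotent `E_j` (`0 ≤ j ≤ D`) of the Bose-Mesner algebra in the standard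
ordering: the orthogonal projection of `V` onto the eigenspace of `A_1` for `θ_j`. (The matrix
`A_1` generates the Bose-Mesner algebra and has the `D + 1` distinct eigenvalues
`θ_0 > θ_1 > ... > θ_D`, so these projections are its primitive idempotents.) -/
noncomputable def primIdem (D q j : ℕ) : StdModule D q →L[ℂ] StdModule D q :=
  (Module.End.eigenspace (assocMap D q 1) (eigenvalue D q j)).starProjection

variable {D q : ℕ}

/-- The characteristic vector `χ_Y` of a set `Y` of words. -/
noncomputable def charVec (Y : Finset (Fin D → Fin q)) : StdModule D q :=
  WithLp.toLp 2 fun x => if x ∈ Y then 1 else 0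

/-- A (nontrivial) code: a set `Y` of words with `1 < |Y| < |X|`. -/
def IsCode (Y : Finset (Fin D → Fin q)) : Prop :=
  1 < Y.card ∧ Y.card < Fintype.card (Fin D → Fin q)

/-- The minimum distance `δ(Y) = min {i ≠ 0 : ⟨χ_Y, A_i χ_Y⟩ ≠ 0}`.
The set is nonempty whenever `Y` is a code. -/
noncomputable def minDist (Y : Finset (Fin D → Fin q)) : ℕ :=
  sInf {i : ℕ | i ≠ 0 ∧ i ≤ D ∧ inner ℂ (charVec Y) (assocMap D q i (charVec Y)) ≠ 0}

/-- The set `{j ≠ 0 : E_j χ_Y ≠ 0}`, where `0 ≤ j ≤ D`. -/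
def dualSupport (Y : Finset (Fin D → Fin q)) : Set ℕ :=
  {j : ℕ | j ≠ 0 ∧ j ≤ D ∧ primIdem D q j (charVec Y) ≠ 0}

/-- The dual distance `δ*(Y) = min {j ≠ 0 : E_j χ_Y ≠ 0}`.
The set is nonempty whenever `Y` is a code. -/
noncomputable def dualDist (Y : Finset (Fin D → Fin q)) : ℕ :=
  sInf (dualSupport Y)

/-- The dual degree `s*(Y) = |{j ≠ 0 : E_j χ_Y ≠ 0}|`. -/
noncomputable def dualDegree (Y : Finset (Fin D → Fin q)) : ℕ :=
  (dualSupport Y).ncard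

/-- A binary repetition code: `q = 2` and `Y` consists of two words that differ in every
coordinate (an antipodal pair of `H(D,2)`). -/
def IsBinaryRepetitionCode (Y : Finset (Fin D → Fin q)) : Prop :=
  q = 2 ∧ ∃ x y : Fin D → Fin q, (∀ i, x i ≠ y i) ∧ (Y : Set (Fin D → Fin q)) = {x, y}

/-- A bipartite half of `H(D,2)`: `q = 2` and `Y` consists of all words at even distance from some
fixed word, that is, `Y` is one of the two colour classes of the `D`-cube. -/
def IsBipartiteHalf (Y : Finset (Fin D → Fin q)) : Prop :=
  q = 2 ∧ ∃ x : Fin D → Fin q, ∀ y : Fin D → Fin q, y ∈ Y ↔ Even (hammingDist x y)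

end HammingScheme

/-! Identify words with characters of (ℤ/q)^D. The characters of weight j span the eigenspace behind
E_j, so `dualSupport` lists the nonzero weights carrying a nonzero Fourier coefficient of χ_Y
(`mem_dualSupport_iff`). Suppose δ ≥ δ* + s*. Let c be the polynomial of degree s* - 1 vanishing on
the dual support except at δ*. For u of weight δ* and z ∈ Y, sum c(|w|) w(z) χ̂_Y(w) over the words
w extending u. Every w ≠ u has larger weight and contributes 0, leaving c(δ*) u(z) χ̂_Y(u).
Expanding χ̂_Y over Y instead, a codeword y ≠ z contributes 0, because z and y differ in more than
|u| + deg c coordinates (`sum_extensions_eval_eq_zero`). What remains is ∑ c(|w|), which is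
independent of z and depends on u only through its weight. Hence u is constant on Y
(`wordChar_eq_of_dualDist_add_dualDegree_le`). For q ≥ 3 such characters separate words, which is
impossible; for q = 2 they force distinct codewords to be antipodal, so Y is a repetition code. -/

namespace HammingScheme

open Finset ComplexConjugate

/-! ### Characters of (ℤ/q)^D as eigenvectors of A_1 -/

section Characters

variable {D q : ℕ}

/-- The symmetric pairing `(a, b) ↦ exp (2 π i a b / q)` on the alphabet. -/
noncomputable def pairing (a b : Fin q) : ℂ :=
  Complex.exp (2 * Real.pi * Complex.I / q) ^ (a.val * b.val)

/-- The character of `(ℤ/q)^D` attached to the word `u`. -/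
noncomputable def wordChar (u x : Fin D → Fin q) : ℂ := ∏ i, pairing (u i) (x i)

lemma pairing_comm (a b : Fin q) : pairing a b = pairing b a := by
  simp only [pairing, Nat.mul_comm]

lemma wordChar_comm (u x : Fin D → Fin q) : wordChar u x = wordChar x u :=
  Finset.prod_congr rfl fun _ _ => pairing_comm _ _

lemma isPrimitiveRoot_exp [NeZero q] :
    IsPrimitiveRoot (Complex.exp (2 * Real.pi * Complex.I / q)) q :=
  Complex.isPrimitiveRoot_exp q (NeZero.ne q)

lemma pairing_mul_conj [NeZero q] (a b : Fin q) : pairing a b * conj (pairing a b) = 1 := by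
  have h : ‖pairing a b‖ = 1 := by
    rw [pairing, norm_pow, isPrimitiveRoot_exp.norm'_eq_one (NeZero.ne q), one_pow]
  rw [Complex.mul_conj, Complex.normSq_eq_norm_sq, h]
  norm_num

lemma pairing_ne_zero [NeZero q] (a b : Fin q) : pairing a b ≠ 0 :=
  left_ne_zero_of_mul_eq_one (pairing_mul_conj a b)

lemma conj_pairing [NeZero q] (a b : Fin q) : conj (pairing a b) = (pairing a b)⁻¹ :=
  eq_inv_of_mul_eq_one_right (pairing_mul_conj a b)

@[simp]
lemma pairing_zero_left [NeZero q] (b : Fin q) : pairing 0 b = 1 := by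
  simp [pairing]

lemma sum_pairing_mul_conj [NeZero q] (x y : Fin q) :
    ∑ a, pairing a x * conj (pairing a y) = if x = y then (q : ℂ) else 0 := by
  split_ifs with h
  · subst h
    simp [pairing_mul_conj]
  · set ζ := Complex.exp (2 * Real.pi * Complex.I / q) with hζ
    have hp : IsPrimitiveRoot ζ q := isPrimitiveRoot_exp
    have h0 : ζ ≠ 0 := hp.ne_zero (NeZero.ne q)
    have hω : ζ ^ x.val / ζ ^ y.val ≠ 1 := fun he => h <| Fin.ext <|
      hp.pow_inj x.isLt y.isLt ((div_eq_one_iff_eq (pow_ne_zero _ h0)).1 he)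
    have hs : ∀ a : Fin q, pairing a x * conj (pairing a y) =
        (ζ ^ x.val / ζ ^ y.val) ^ a.val := by
      intro a
      rw [conj_pairing, pairing, pairing, ← hζ, div_pow, ← pow_mul, ← pow_mul,
        Nat.mul_comm x.val, Nat.mul_comm y.val, div_eq_mul_inv]
    simp only [hs]
    rw [Fin.sum_univ_eq_sum_range (fun n => (ζ ^ x.val / ζ ^ y.val) ^ n), geom_sum_eq hω, div_pow,
      ← pow_mul, ← pow_mul, Nat.mul_comm, pow_mul, Nat.mul_comm, pow_mul, hp.pow_eq_one]
    simp

/-- The sum factors over the coordinates, and a coordinate where the words differ gives a vanishing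
factor. -/
lemma sum_wordChar_mul_conj [NeZero q] (x y : Fin D → Fin q) :
    ∑ u, wordChar u x * conj (wordChar u y) = if x = y then (q : ℂ) ^ D else 0 := by
  have h : ∀ u : Fin D → Fin q, wordChar u x * conj (wordChar u y) =
      ∏ i, pairing (u i) (x i) * conj (pairing (u i) (y i)) := by
    intro u
    rw [wordChar, wordChar, map_prod, Finset.prod_mul_distrib]
  simp only [h]
  rw [← Fintype.piFinset_univ,
    ← Finset.prod_univ_sum (fun _ => univ) fun i a => pairing a (x i) * conj (pairing a (y i))]
  simp only [sum_pairing_mul_conj]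
  split_ifs with hxy
  · subst hxy
    simp
  · obtain ⟨i, hi⟩ := Function.ne_iff.1 hxy
    exact Finset.prod_eq_zero (Finset.mem_univ i) (if_neg hi)

lemma wordChar_ne_zero [NeZero q] (u x : Fin D → Fin q) : wordChar u x ≠ 0 :=
  Finset.prod_ne_zero_iff.2 fun _ _ => pairing_ne_zero _ _

@[simp]
lemma wordChar_zero_left [NeZero q] (x : Fin D → Fin q) : wordChar 0 x = 1 := by
  simp [wordChar]

/-- The neighbours of `x` in the Hamming graph arise by changing one coordinate. -/
lemma sum_neighbours {M : Type*} [AddCommMonoid M] (x : Fin D → Fin q) (F : (Fin D → Fin q) → M) :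
    ∑ y with hammingDist x y = 1, F y =
      ∑ i, ∑ a with a ≠ x i, F (Function.update x i a) := by
  rw [Finset.sum_sigma']
  symm
  refine Finset.sum_bij (fun p _ => Function.update x p.1 p.2) ?_ ?_ ?_ (fun _ _ => rfl)
  · rintro ⟨i, a⟩ h
    simp only [mem_sigma, mem_univ, mem_filter, true_and] at h
    simp only [mem_filter, mem_univ, true_and, hammingDist]
    rw [Finset.card_eq_one]
    refine ⟨i, ?_⟩
    ext k
    by_cases hk : k = i
    · subst hk
      simp [h.symm]
    · simp [hk]
  · rintro ⟨i, a⟩ h ⟨k, b⟩ h' he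
    simp only [mem_sigma, mem_univ, mem_filter, true_and] at h h' he
    have hik : i = k := by
      by_contra hne
      have := congrFun he i
      rw [Function.update_self, Function.update_of_ne hne] at this
      exact h this
    subst hik
    have := congrFun he i
    simp only [Function.update_self] at this
    rw [this]
  · intro y hy
    simp only [mem_filter, mem_univ, true_and, hammingDist] at hy
    obtain ⟨i, hi⟩ := Finset.card_eq_one.1 hy
    have hk : ∀ k, x k ≠ y k ↔ k = i := by
      intro k
      have := Finset.ext_iff.1 hi k
      simpa using this
    refine ⟨⟨i, y i⟩, ?_, ?_⟩
    · simpa using ((hk i).2 rfl).symm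
    · ext1 k
      by_cases h : k = i
      · subst h
        simp
      · rw [Function.update_of_ne h]
        exact not_not.1 (mt (hk k).1 h)

lemma wordChar_update [NeZero q] (u x : Fin D → Fin q) (i : Fin D) (a : Fin q) :
    wordChar u (Function.update x i a) =
      wordChar u x * (pairing a (u i) * conj (pairing (x i) (u i))) := by
  rw [wordChar, wordChar, ← Finset.mul_prod_erase _ _ (Finset.mem_univ i),
    ← Finset.mul_prod_erase (a := i) _ (fun i => pairing (u i) (x i)) (Finset.mem_univ i),
    Function.update_self, conj_pairing, pairing_comm (x i)]
  have h : ∏ k ∈ univ.erase i, pairing (u k) (Function.update x i a k) =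
      ∏ k ∈ univ.erase i, pairing (u k) (x k) :=
    Finset.prod_congr rfl fun k hk => by rw [Function.update_of_ne (Finset.ne_of_mem_erase hk)]
  rw [h, pairing_comm a]
  field_simp [pairing_ne_zero]

lemma sum_pairing_ne [NeZero q] (b c : Fin q) :
    ∑ a with a ≠ b, pairing a c * conj (pairing b c) = (if c = 0 then (q : ℂ) else 0) - 1 := by
  have h1 : ∑ a, pairing a c = if c = 0 then (q : ℂ) else 0 := by
    have := sum_pairing_mul_conj c 0
    simpa [pairing_comm _ (0 : Fin q)] using this
  have h2 : ∑ a, pairing a c * conj (pairing b c) = if c = 0 then (q : ℂ) else 0 := by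
    rw [← Finset.sum_mul, h1]
    split_ifs with hc
    · subst hc
      simp [pairing_comm _ (0 : Fin q)]
    · simp
  rw [← h2, ← Finset.sum_filter_add_sum_filter_not univ (fun a => a ≠ b)]
  simp [Finset.filter_eq', pairing_mul_conj]

/-- The character of `u` as a vector of the standard module. -/
noncomputable def charVector (u : Fin D → Fin q) : StdModule D q := WithLp.toLp 2 (wordChar u)

lemma assocMap_apply (i : ℕ) (v : StdModule D q) (x : Fin D → Fin q) :
    assocMap D q i v x = ∑ y with hammingDist x y = i, v y := by
  simp [assocMap, assocMatrix, Matrix.toLpLin_apply, Matrix.mulVec, dotProduct, Finset.sum_filter]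

/-- Changing coordinate `i` in all possible ways multiplies the character by a total of q - 1 if `u
i = 0`, and of -1 otherwise. -/
lemma assocMap_one_charVector [NeZero q] (u : Fin D → Fin q) :
    assocMap D q 1 (charVector u) = eigenvalue D q (hammingNorm u) • charVector u := by
  ext x
  rw [assocMap_apply, sum_neighbours]
  simp only [charVector, wordChar_update, ← Finset.mul_sum, sum_pairing_ne, PiLp.smul_apply,
    smul_eq_mul]
  rw [mul_comm]
  congr 1
  have h : ∑ i, (if u i = 0 then (q : ℂ) else 0) = q * (D - hammingNorm u) := by
    have hc := Finset.card_filter_add_card_filter_not (s := (univ : Finset (Fin D)))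
      (fun i => u i = 0)
    rw [Finset.card_univ, Fintype.card_fin] at hc
    have hc' : ((#{i | u i = 0} : ℕ) : ℂ) + (hammingNorm u : ℕ) = D := by
      exact_mod_cast hc
    rw [← Finset.sum_filter, Finset.sum_const, nsmul_eq_mul]
    linear_combination (q : ℂ) * hc'
  rw [Finset.sum_sub_distrib, h, eigenvalue]
  simp
  ring

end Characters

end HammingScheme

namespace HammingScheme

open Finset ComplexConjugate

/-! ### Fourier description of the dual support; minimum distance -/

section Fourier

variable {D q : ℕ}

/-- The Fourier coefficient of the characteristic function of `Y` at `u`. -/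
noncomputable def fourierCoeff (Y : Finset (Fin D → Fin q)) (u : Fin D → Fin q) : ℂ :=
  ∑ y ∈ Y, conj (wordChar u y)

lemma sum_mul_fourierCoeff (Y : Finset (Fin D → Fin q)) (s : Finset (Fin D → Fin q))
    (c : (Fin D → Fin q) → ℂ) (x : Fin D → Fin q) :
    ∑ w ∈ s, c w * (wordChar w x * fourierCoeff Y w) =
      ∑ y ∈ Y, ∑ w ∈ s, c w * (wordChar w x * conj (wordChar w y)) := by
  rw [Finset.sum_comm]
  simp only [fourierCoeff, Finset.mul_sum]

lemma inner_charVector (u : Fin D → Fin q) (v : StdModule D q) :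
    inner ℂ (charVector u) v = ∑ y, v y * conj (wordChar u y) := by
  simp [PiLp.inner_apply, charVector]

lemma inner_charVector_charVec (Y : Finset (Fin D → Fin q)) (u : Fin D → Fin q) :
    inner ℂ (charVector u) (charVec Y) = fourierCoeff Y u := by
  rw [inner_charVector, fourierCoeff]
  simp [charVec]

lemma fourier_inversion [NeZero q] (v : StdModule D q) :
    ∑ u, inner ℂ (charVector u) v • charVector u = ((q : ℂ) ^ D) • v := by
  ext x
  simp only [inner_charVector, WithLp.ofLp_sum, Finset.sum_apply, PiLp.smul_apply, smul_eq_mul,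
    Finset.sum_mul]
  rw [Finset.sum_comm]
  have h : ∀ y, ∑ u, v y * conj (wordChar u y) * (charVector u) x =
      v y * if x = y then (q : ℂ) ^ D else 0 := by
    intro y
    rw [← sum_wordChar_mul_conj, Finset.mul_sum]
    exact Finset.sum_congr rfl fun u _ => by
      rw [charVector]
      ring
  simp only [h]
  simp [mul_comm]

lemma assocMap_isSymmetric (i : ℕ) : (assocMap D q i).IsSymmetric := by
  rw [assocMap]
  refine Matrix.isSymmetric_toEuclideanLin_iff.2 ?_
  ext x y
  simp [assocMatrix, hammingDist_comm, apply_ite]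

lemma eigenvalue_inj [NeZero q] {i j : ℕ} : eigenvalue D q i = eigenvalue D q j ↔ i = j := by
  have : (q : ℂ) ≠ 0 := NeZero.ne _
  simp [eigenvalue, this]

lemma conj_eigenvalue (j : ℕ) : conj (eigenvalue D q j) = eigenvalue D q j := by
  simp [eigenvalue]

lemma charVector_mem_eigenspace [NeZero q] (u : Fin D → Fin q) :
    charVector u ∈ Module.End.eigenspace (assocMap D q 1) (eigenvalue D q (hammingNorm u)) :=
  Module.End.mem_eigenspace_iff.2 (assocMap_one_charVector u)

lemma inner_charVector_eq_zero [NeZero q] {j : ℕ} {v : StdModule D q}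
    (hv : v ∈ Module.End.eigenspace (assocMap D q 1) (eigenvalue D q j)) {u : Fin D → Fin q}
    (hu : hammingNorm u ≠ j) : inner ℂ (charVector u) v = 0 := by
  have h := assocMap_isSymmetric (D := D) (q := q) 1 (charVector u) v
  rw [assocMap_one_charVector, Module.End.mem_eigenspace_iff.1 hv, inner_smul_left,
    inner_smul_right, conj_eigenvalue] at h
  by_contra h0
  exact hu (eigenvalue_inj.1 (mul_right_cancel₀ h0 h))

/-- `E_j v = 0` exactly when all Fourier coefficients of `v` of weight `j` vanish. -/
lemma primIdem_eq_zero_iff [NeZero q] (j : ℕ) (v : StdModule D q) :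
    primIdem D q j v = 0 ↔ ∀ u, hammingNorm u = j → inner ℂ (charVector u) v = 0 := by
  rw [primIdem, Submodule.starProjection_apply_eq_zero_iff, Submodule.mem_orthogonal]
  constructor
  · rintro h u rfl
    exact h _ (charVector_mem_eigenspace u)
  · intro h w hw
    have hq : (q : ℂ) ^ D ≠ 0 := pow_ne_zero _ (NeZero.ne _)
    -- Fourier inversion writes `w` through characters; those of weight other than `j` are
    -- orthogonal to the eigenvector `w`.
    have h0 : inner ℂ (((q : ℂ) ^ D) • w) v = 0 := by
      rw [← fourier_inversion, sum_inner]
      refine Finset.sum_eq_zero fun u _ => ?_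
      rw [inner_smul_left]
      by_cases hu : hammingNorm u = j
      · rw [h u hu, mul_zero]
      · rw [inner_charVector_eq_zero hw hu, map_zero, zero_mul]
    rw [inner_smul_left] at h0
    exact (mul_eq_zero.1 h0).resolve_left (by simpa using hq)

lemma mem_dualSupport_iff [NeZero q] {Y : Finset (Fin D → Fin q)} {j : ℕ} :
    j ∈ dualSupport Y ↔ j ≠ 0 ∧ ∃ u, hammingNorm u = j ∧ fourierCoeff Y u ≠ 0 := by
  rw [dualSupport, Set.mem_ofPred_eq, Ne, Ne, primIdem_eq_zero_iff]
  simp only [inner_charVector_charVec]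
  push Not
  refine and_congr_right fun _ => ⟨fun h => h.2, fun h => ⟨?_, h⟩⟩
  obtain ⟨u, rfl, -⟩ := h
  exact hammingNorm_le_card_fintype.trans_eq (Fintype.card_fin D)

lemma dualSupport_finite (Y : Finset (Fin D → Fin q)) : (dualSupport Y).Finite :=
  (Set.finite_Iic D).subset fun _ h => h.2.1

/-- Otherwise only the trivial character would occur in χ_Y, making it constant, although `Y` is
neither empty nor everything. -/
lemma dualSupport_nonempty [NeZero q] {Y : Finset (Fin D → Fin q)} (hY : IsCode Y) :
    (dualSupport Y).Nonempty := by
  by_contra hne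
  have h0 : ∀ u : Fin D → Fin q, u ≠ 0 → fourierCoeff Y u = 0 := by
    intro u hu
    by_contra h
    exact hne ⟨hammingNorm u, mem_dualSupport_iff.2 ⟨by simpa using hu, u, rfl, h⟩⟩
  have hv := fourier_inversion (charVec Y)
  rw [Finset.sum_eq_single 0 (fun u _ hu => by rw [inner_charVector_charVec, h0 u hu, zero_smul])
    (by simp)] at hv
  have hx : ∀ x, fourierCoeff Y 0 = (q : ℂ) ^ D * charVec Y x := by
    intro x
    have := congrArg (fun w : StdModule D q => w x) hv
    rw [inner_charVector_charVec] at this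
    simpa [charVector] using this
  have hq : (q : ℂ) ^ D ≠ 0 := pow_ne_zero _ (NeZero.ne _)
  obtain ⟨y, hy⟩ := Finset.card_pos.1 (zero_lt_one.trans hY.1)
  obtain ⟨z, hz⟩ : ∃ z, z ∉ Y := by
    by_contra! h
    exact hY.2.ne (by rw [Finset.eq_univ_of_forall h, Finset.card_univ])
  have := (hx y).symm.trans (hx z)
  simp [charVec, hy, hz] at this
  exact hq (by simp [this])

lemma inner_assocMap_charVec (Y : Finset (Fin D → Fin q)) (i : ℕ) :
    inner ℂ (charVec Y) (assocMap D q i (charVec Y)) =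
      (#{p ∈ Y ×ˢ Y | hammingDist p.1 p.2 = i} : ℂ) := by
  have h : ∀ x, inner ℂ (charVec Y x) (assocMap D q i (charVec Y) x) =
      if x ∈ Y then ∑ y ∈ Y, if hammingDist x y = i then (1 : ℂ) else 0 else 0 := by
    intro x
    have hf : ({y | hammingDist x y = i} : Finset (Fin D → Fin q)) ∩ Y =
        {y ∈ Y | hammingDist x y = i} := by
      ext y
      simp [and_comm]
    rw [assocMap_apply]
    split_ifs with hx <;> simp [charVec, hx, hf]
  rw [PiLp.inner_apply, Finset.sum_congr rfl fun x _ => h x, Finset.sum_ite_mem,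
    Finset.univ_inter, Finset.card_filter, Finset.sum_product]
  push_cast
  rfl

lemma inner_assocMap_charVec_ne_zero_iff (Y : Finset (Fin D → Fin q)) (i : ℕ) :
    inner ℂ (charVec Y) (assocMap D q i (charVec Y)) ≠ 0 ↔
      ∃ x ∈ Y, ∃ y ∈ Y, hammingDist x y = i := by
  rw [inner_assocMap_charVec, Ne, Nat.cast_eq_zero, Finset.card_eq_zero, ← Ne,
    ← Finset.nonempty_iff_ne_empty]
  constructor
  · rintro ⟨⟨x, y⟩, h⟩
    rw [Finset.mem_filter, Finset.mem_product] at h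
    exact ⟨x, h.1.1, y, h.1.2, h.2⟩
  · rintro ⟨x, hx, y, hy, h⟩
    exact ⟨(x, y), Finset.mem_filter.2 ⟨Finset.mem_product.2 ⟨hx, hy⟩, h⟩⟩

lemma minDist_le {Y : Finset (Fin D → Fin q)} {x y : Fin D → Fin q} (hx : x ∈ Y) (hy : y ∈ Y)
    (hxy : x ≠ y) : minDist Y ≤ hammingDist x y :=
  Nat.sInf_le ⟨by simpa using hxy,
    hammingDist_le_card_fintype.trans_eq (Fintype.card_fin D),
    (inner_assocMap_charVec_ne_zero_iff Y _).2 ⟨x, hx, y, hy, rfl⟩⟩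

lemma exists_hammingDist_eq_minDist {Y : Finset (Fin D → Fin q)} (hY : IsCode Y) :
    ∃ x ∈ Y, ∃ y ∈ Y, x ≠ y ∧ hammingDist x y = minDist Y := by
  obtain ⟨x, hx, y, hy, hxy⟩ := Finset.one_lt_card.1 hY.1
  obtain ⟨h0, -, h⟩ := Nat.sInf_mem (s := {i : ℕ | i ≠ 0 ∧ i ≤ D ∧
    inner ℂ (charVec Y) (assocMap D q i (charVec Y)) ≠ 0}) ⟨hammingDist x y, by simpa using hxy,
      hammingDist_le_card_fintype.trans_eq (Fintype.card_fin D),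
      (inner_assocMap_charVec_ne_zero_iff Y _).2 ⟨x, hx, y, hy, rfl⟩⟩
  obtain ⟨x, hx, y, hy, h⟩ := (inner_assocMap_charVec_ne_zero_iff Y _).1 h
  refine ⟨x, hx, y, hy, ?_, h⟩
  rintro rfl
  exact h0 (by rw [← h, hammingDist_self])

end Fourier

end HammingScheme

namespace HammingScheme

open Finset ComplexConjugate Polynomial

/-! ### The polynomial argument over extensions of a word -/

section Bound

variable {D q : ℕ} [NeZero q]

/-- The words that agree with `u` on the support of `u`. -/
def extensions (u : Fin D → Fin q) : Finset (Fin D → Fin q) := {w | ∀ i, u i = 0 ∨ w i = u i}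

lemma mem_extensions {u w : Fin D → Fin q} : w ∈ extensions u ↔ ∀ i, u i = 0 ∨ w i = u i := by
  simp [extensions]

lemma hammingNorm_eq_sum (w : Fin D → Fin q) :
    (hammingNorm w : ℂ) = ∑ i, if w i = 0 then 0 else 1 := by
  rw [hammingNorm, Finset.card_filter]
  push_cast
  exact Finset.sum_congr rfl fun i _ => by split_ifs <;> simp_all

lemma support_subset_of_mem_extensions {u w : Fin D → Fin q} (hw : w ∈ extensions u) :
    ({i | u i ≠ 0} : Finset (Fin D)) ⊆ ({i | w i ≠ 0} : Finset (Fin D)) := by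
  intro i hi
  simp only [mem_filter, mem_univ, true_and] at hi ⊢
  rwa [(mem_extensions.1 hw i).resolve_left hi]

lemma hammingNorm_le_of_mem_extensions {u w : Fin D → Fin q} (hw : w ∈ extensions u) :
    hammingNorm u ≤ hammingNorm w :=
  Finset.card_le_card (support_subset_of_mem_extensions hw)

lemma eq_of_mem_extensions {u w : Fin D → Fin q} (hw : w ∈ extensions u)
    (h : hammingNorm w = hammingNorm u) : w = u := by
  have hs := Finset.eq_of_subset_of_card_le (support_subset_of_mem_extensions hw) h.le
  ext1 i
  rcases mem_extensions.1 hw i with hi | hi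
  · have := Finset.ext_iff.1 hs i
    simp only [mem_filter, mem_univ, true_and] at this
    rw [hi]
    by_contra hwi
    exact this.2 hwi hi
  · exact hi

/-- A sum over the extensions of `u` of a product function factors over the coordinates. -/
lemma sum_extensions_prod {R : Type*} [CommSemiring R] (u : Fin D → Fin q)
    (g : Fin D → Fin q → R) :
    ∑ w ∈ extensions u, ∏ i, g i (w i) =
      ∏ i, if u i = 0 then ∑ a, g i a else g i (u i) := by
  have h : extensions u = Fintype.piFinset fun i => if u i = 0 then univ else {u i} := by
    ext w
    rw [mem_extensions, Fintype.mem_piFinset]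
    refine forall_congr' fun i => ?_
    split_ifs with hi <;> simp [hi]
  rw [h, ← Finset.prod_univ_sum]
  refine Finset.prod_congr rfl fun i _ => ?_
  split_ifs <;> simp

/-- Twisted power moments over the extensions of `u` vanish at pairs of words that are far apart. -/
lemma sum_extensions_pow_eq_zero (u x y : Fin D → Fin q) (l : ℕ)
    (h : hammingNorm u + l < hammingDist x y) :
    ∑ w ∈ extensions u, (hammingNorm w : ℂ) ^ l * (wordChar w x * conj (wordChar w y)) = 0 := by
  -- Expand |w|^l over `l`-tuples `f` of coordinates: each term is a product over coordinates,
  -- twisted only at those in the image of `f`.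
  have hexp : ∀ w : Fin D → Fin q,
      (hammingNorm w : ℂ) ^ l * (wordChar w x * conj (wordChar w y)) =
        ∑ f : Fin l → Fin D, ∏ i, (∏ k with f k = i, if w i = 0 then (0 : ℂ) else 1) *
          (pairing (w i) (x i) * conj (pairing (w i) (y i))) := by
    intro w
    rw [hammingNorm_eq_sum, Fintype.sum_pow, Finset.sum_mul]
    refine Finset.sum_congr rfl fun f _ => ?_
    rw [Finset.prod_mul_distrib, Finset.prod_mul_distrib, wordChar, wordChar, map_prod]
    congr 1
    rw [← Finset.prod_fiberwise univ f]
    refine Finset.prod_congr rfl fun i _ => Finset.prod_congr rfl fun k hk => ?_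
    rw [(Finset.mem_filter.1 hk).2]
  simp only [hexp]
  rw [Finset.sum_comm]
  refine Finset.sum_eq_zero fun f _ => ?_
  rw [sum_extensions_prod u fun i a => (∏ k with f k = i, if a = 0 then (0 : ℂ) else 1) *
    (pairing a (x i) * conj (pairing a (y i)))]
  -- Some coordinate separating `x` and `y` lies outside both the support of `u` and the image of
  -- `f`; there `w i` is free and the untwisted character sum vanishes.
  have hcard : #(({i | u i ≠ 0} : Finset (Fin D)) ∪ univ.image f) <
      #({i | x i ≠ y i} : Finset (Fin D)) := by
    refine (Finset.card_union_le _ _).trans_lt (lt_of_le_of_lt ?_ h)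
    exact Nat.add_le_add_left (Finset.card_image_le.trans_eq (by simp)) _
  obtain ⟨i, hi, hni⟩ := Finset.exists_mem_notMem_of_card_lt_card hcard
  simp only [mem_filter, mem_univ, true_and, mem_union, mem_image, not_or, not_not, not_exists]
    at hi hni
  refine Finset.prod_eq_zero (Finset.mem_univ i) ?_
  rw [if_pos hni.1]
  have hf : ({k | f k = i} : Finset (Fin l)) = ∅ := by
    simpa [Finset.filter_eq_empty_iff] using hni.2
  simp only [hf, Finset.prod_empty, one_mul]
  rw [sum_pairing_mul_conj, if_neg hi]

lemma sum_extensions_eval_eq_zero (c : ℂ[X]) (u x y : Fin D → Fin q)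
    (h : hammingNorm u + c.natDegree < hammingDist x y) :
    ∑ w ∈ extensions u, c.eval (hammingNorm w : ℂ) * (wordChar w x * conj (wordChar w y)) = 0 := by
  simp only [Polynomial.eval_eq_sum_range, Finset.sum_mul]
  rw [Finset.sum_comm]
  refine Finset.sum_eq_zero fun l hl => ?_
  simp only [mul_assoc]
  rw [← Finset.mul_sum, sum_extensions_pow_eq_zero u x y l, mul_zero]
  have := Finset.mem_range.1 hl
  omega

/-- The weight distribution of the extensions of `u` depends only on the weight of `u`. -/
lemma sum_extensions_X_pow (u : Fin D → Fin q) :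
    ∑ w ∈ extensions u, (X : ℂ[X]) ^ hammingNorm w =
      X ^ hammingNorm u * (∑ a : Fin q, if a = 0 then 1 else X) ^ (D - hammingNorm u) := by
  have h : ∀ w : Fin D → Fin q, (X : ℂ[X]) ^ hammingNorm w = ∏ i, if w i = 0 then 1 else X := by
    intro w
    rw [Finset.prod_ite, Finset.prod_const_one, one_mul, Finset.prod_const]
    rfl
  simp only [h]
  rw [sum_extensions_prod u fun _ a => if a = 0 then (1 : ℂ[X]) else X]
  have h2 : ∀ i, (if u i = 0 then ∑ a : Fin q, (if a = 0 then (1 : ℂ[X]) else X) else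
      if u i = 0 then 1 else X) =
      if u i = 0 then ∑ a : Fin q, (if a = 0 then (1 : ℂ[X]) else X) else X := by
    intro i
    split_ifs <;> rfl
  simp only [h2]
  rw [← h, Finset.prod_ite, Finset.prod_const, Finset.prod_const, mul_comm]
  have hc := Finset.card_filter_add_card_filter_not (s := (univ : Finset (Fin D)))
    (fun i => u i = 0)
  rw [Finset.card_univ, Fintype.card_fin] at hc
  have h3 : #({i | u i = 0} : Finset (Fin D)) = D - hammingNorm u := by
    simp only [hammingNorm]
    exact Nat.eq_sub_of_add_eq hc
  rw [h3]
  rfl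

lemma sum_extensions_eq_of_hammingNorm_eq (c : ℕ → ℂ) {u v : Fin D → Fin q}
    (h : hammingNorm u = hammingNorm v) :
    ∑ w ∈ extensions u, c (hammingNorm w) = ∑ w ∈ extensions v, c (hammingNorm w) := by
  -- Apply the linear functional X^n ↦ c n to the weight enumerator.
  have hc : ∀ u : Fin D → Fin q, ∑ w ∈ extensions u, c (hammingNorm w) =
      Polynomial.lsum (fun n => LinearMap.mulLeft ℂ (c n))
        (∑ w ∈ extensions u, (X : ℂ[X]) ^ hammingNorm w) := by
    intro u
    rw [map_sum]
    refine Finset.sum_congr rfl fun w _ => ?_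
    rw [Polynomial.lsum_apply, ← Polynomial.monomial_one_right_eq_X_pow,
      Polynomial.sum_monomial_index _ _ (by simp)]
    simp
  rw [hc, hc, sum_extensions_X_pow, sum_extensions_X_pow, h]

lemma wordChar_mul_conj_self (u x : Fin D → Fin q) :
    wordChar u x * conj (wordChar u x) = 1 := by
  rw [wordChar, map_prod, ← Finset.prod_mul_distrib]
  exact Finset.prod_eq_one fun i _ => pairing_mul_conj _ _

/-- If the minimum distance is at least the dual distance plus the dual degree, then every
character whose weight is the dual distance is constant on the code. -/
lemma wordChar_eq_of_dualDist_add_dualDegree_le {Y : Finset (Fin D → Fin q)} (hY : IsCode Y)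
    (h : dualDist Y + dualDegree Y ≤ minDist Y) {u : Fin D → Fin q}
    (hu : hammingNorm u = dualDist Y) {x y : Fin D → Fin q} (hx : x ∈ Y) (hy : y ∈ Y) :
    wordChar u x = wordChar u y := by
  set S := (dualSupport_finite Y).toFinset with hS
  have hmem : dualDist Y ∈ S := by
    rw [hS, Set.Finite.mem_toFinset]
    exact Nat.sInf_mem (dualSupport_nonempty hY)
  have hcard : #S = dualDegree Y := by
    rw [dualDegree, Set.ncard_eq_toFinset_card _ (dualSupport_finite Y)]
  -- Omitting δ* keeps `c` nonzero there and makes its degree s* - 1, the largest that the distance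
  -- hypothesis allows.
  set c : ℂ[X] := ∏ j ∈ S.erase (dualDist Y), (X - C (j : ℂ)) with hc
  have hdeg : c.natDegree = dualDegree Y - 1 := by
    rw [hc, Polynomial.natDegree_prod_of_monic _ _ fun j _ => monic_X_sub_C _]
    simp only [Polynomial.natDegree_X_sub_C, Finset.sum_const, smul_eq_mul, mul_one]
    rw [Finset.card_erase_of_mem hmem, hcard]
  have hpos : 0 < dualDegree Y := hcard ▸ Finset.card_pos.2 ⟨_, hmem⟩
  have h0 : dualDist Y ≠ 0 := (Nat.sInf_mem (dualSupport_nonempty hY)).1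
  have hcne : c.eval (dualDist Y : ℂ) ≠ 0 := by
    rw [hc, Polynomial.eval_prod, Finset.prod_ne_zero_iff]
    intro j hj
    rw [Polynomial.eval_sub, Polynomial.eval_X, Polynomial.eval_C, sub_ne_zero, Ne, Nat.cast_inj]
    exact (Finset.ne_of_mem_erase hj).symm
  have key : ∀ v : Fin D → Fin q, hammingNorm v = dualDist Y → ∀ z ∈ Y,
      c.eval (dualDist Y : ℂ) * (wordChar v z * fourierCoeff Y v) =
        ∑ w ∈ extensions v, c.eval (hammingNorm w : ℂ) := by
    intro v hv z hz
    have hl : ∑ w ∈ extensions v, c.eval (hammingNorm w : ℂ) * (wordChar w z * fourierCoeff Y w) =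
        c.eval (dualDist Y : ℂ) * (wordChar v z * fourierCoeff Y v) := by
      rw [← hv]
      refine Finset.sum_eq_single_of_mem v (mem_extensions.2 fun i => Or.inr rfl) ?_
      intro w hw hwv
      by_cases hf : fourierCoeff Y w = 0
      · rw [hf, mul_zero, mul_zero]
      · have hle := hammingNorm_le_of_mem_extensions hw
        have hwS : hammingNorm w ∈ S.erase (dualDist Y) := by
          refine Finset.mem_erase.2 ⟨fun he => hwv (eq_of_mem_extensions hw (he.trans hv.symm)), ?_⟩
          rw [hS, Set.Finite.mem_toFinset, mem_dualSupport_iff]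
          exact ⟨by omega, w, rfl, hf⟩
        rw [hc, Polynomial.eval_prod, Finset.prod_eq_zero hwS (by simp), zero_mul]
    -- The same sum expanded over codewords: only `z` survives, since |v| + deg c = δ* + s* - 1 < δ.
    rw [← hl, sum_mul_fourierCoeff, Finset.sum_eq_single_of_mem z hz]
    · simp only [wordChar_mul_conj_self, mul_one]
    · intro y hy hyz
      refine sum_extensions_eval_eq_zero c v z y ?_
      have := minDist_le hz hy hyz.symm
      omega
  obtain ⟨-, v, hv, hvne⟩ := mem_dualSupport_iff.1 (Nat.sInf_mem (dualSupport_nonempty hY))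
  -- One word `v` of weight δ* has a nonzero coefficient; as the right side of `key` depends only on
  -- the weight, so does every `u` of that weight.
  have hne : c.eval (dualDist Y : ℂ) * (wordChar u x * fourierCoeff Y u) ≠ 0 := by
    rw [key u hu x hx, sum_extensions_eq_of_hammingNorm_eq (fun n => c.eval (n : ℂ))
      (hu.trans hv.symm), ← key v hv x hx]
    exact mul_ne_zero hcne (mul_ne_zero (wordChar_ne_zero _ _) hvne)
  have hxy := (key u hu x hx).trans (key u hu y hy).symm
  exact mul_right_cancel₀ (right_ne_zero_of_mul (right_ne_zero_of_mul hne))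
    (mul_left_cancel₀ hcne hxy)

end Bound

end HammingScheme

namespace HammingScheme

open Finset ComplexConjugate

/-! ### Words not separated by the characters of a fixed weight -/

section Repetition

variable {D q : ℕ}

lemma pairing_one_pow (h : 1 < q) (n : ℕ) (hn : n < q) (a : Fin q) :
    pairing ⟨n, hn⟩ a = pairing ⟨1, h⟩ a ^ n := by
  rw [pairing, pairing, ← pow_mul, one_mul, Nat.mul_comm]

lemma pairing_one_injective [NeZero q] (h : 1 < q) :
    Function.Injective (pairing (⟨1, h⟩ : Fin q)) := by
  intro a b hab
  rw [pairing, pairing, one_mul, one_mul] at hab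
  exact Fin.ext (isPrimitiveRoot_exp.pow_inj a.isLt b.isLt hab)

lemma wordChar_update_left [NeZero q] (u x : Fin D → Fin q) (i : Fin D) (a : Fin q) :
    wordChar (Function.update u i a) x =
      wordChar u x * (pairing a (x i) * conj (pairing (u i) (x i))) := by
  rw [wordChar_comm, wordChar_update, wordChar_comm]

/-- Two distinct words on which all characters of weight `k` agree, where `0 < k < D`, differ
everywhere. -/
lemma forall_ne_of_wordChar_eq [NeZero q] (hq : 1 < q) {k : ℕ} (hk : 0 < k) (hkD : k < D)
    {x y : Fin D → Fin q} (hxy : x ≠ y)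
    (h : ∀ u : Fin D → Fin q, hammingNorm u = k → wordChar u x = wordChar u y) (i : Fin D) :
    x i ≠ y i := by
  intro hi
  refine hxy (funext fun j => ?_)
  by_cases hij : j = i
  · rw [hij, hi]
  -- Move one unit of support from `i` to `j`, keeping weight `k`. As `x` and `y` agree at `i`,
  -- comparing the two characters isolates coordinate `j`; room for `j` outside `T` is where `k < D`
  -- enters.
  obtain ⟨T, hiT, hT, hTk⟩ := Finset.exists_subsuperset_card_eq (s := {i})
    (t := (univ : Finset (Fin D)).erase j) (n := k) (by simpa using Ne.symm hij) (by rw [Finset.card_singleton]; exact hk)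
    (by rw [Finset.card_erase_of_mem (Finset.mem_univ _), Finset.card_univ, Fintype.card_fin]; omega)
  have hiT : i ∈ T := Finset.singleton_subset_iff.1 hiT
  have hjT : j ∉ T := fun hj => Finset.notMem_erase j univ (hT hj)
  set o : Fin q := ⟨1, hq⟩ with ho
  have ho0 : o ≠ 0 := by
    simp [ho, Fin.ext_iff]
  set u : Fin D → Fin q := fun m => if m ∈ T then o else 0 with hu
  have hnu : hammingNorm u = k := by
    simp [hammingNorm, hu, ho0, hTk]
  have hnu' : hammingNorm (Function.update (Function.update u i 0) j o) = k := by
    have hs : ({m | Function.update (Function.update u i 0) j o m ≠ 0} : Finset (Fin D)) =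
        insert j (T.erase i) := by
      ext m
      by_cases hmj : m = j
      · simp [hmj, ho0]
      · by_cases hmi : m = i
        · simp [hmi, Ne.symm hij]
        · simp [hmj, hmi, hu, ho0]
    rw [hammingNorm, hs, Finset.card_insert_of_notMem (by simp [hjT]),
      Finset.card_erase_of_mem hiT, hTk]
    omega
  have h1 := h _ hnu'
  simp only [wordChar_update_left, Function.update_of_ne hij, h u hnu, hi] at h1
  have huj : u j = 0 := if_neg hjT
  rw [huj] at h1
  have hc : wordChar u y * (pairing 0 (y i) * conj (pairing (u i) (y i))) ≠ 0 := by
    have := pairing_ne_zero (u i) (y i)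
    simp [wordChar_ne_zero, this]
  have h2 := mul_left_cancel₀ hc h1
  simp only [pairing_zero_left, map_one, mul_one] at h2
  exact pairing_one_injective hq h2

/-- Over an alphabet with at least three letters, the characters of a given positive weight
separate words. -/
lemma eq_of_wordChar_eq [NeZero q] (hq : 2 < q) {k : ℕ} (hk : 0 < k) (hkD : k ≤ D)
    {x y : Fin D → Fin q}
    (h : ∀ u : Fin D → Fin q, hammingNorm u = k → wordChar u x = wordChar u y) : x = y := by
  funext i
  obtain ⟨T, hiT, -, hTk⟩ := Finset.exists_subsuperset_card_eq (s := {i})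
    (t := (univ : Finset (Fin D))) (n := k) (by simp) (by rw [Finset.card_singleton]; exact hk) (by simpa using hkD)
  have hiT : i ∈ T := Finset.singleton_subset_iff.1 hiT
  have hq1 : 1 < q := by omega
  have hsupp : ∀ v : Fin D → Fin q, (∀ m, v m ≠ 0 ↔ m ∈ T) → hammingNorm v = k := by
    intro v hv
    simp [hammingNorm, hv, hTk]
  set u : Fin D → Fin q := fun m => if m ∈ T then ⟨1, hq1⟩ else 0 with hu
  have hnu : hammingNorm u = k := hsupp u fun m => by
    by_cases hm : m ∈ T <;> simp [hu, hm, Fin.ext_iff]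
  -- Replacing the letter 1 by 2 at `i` preserves the weight and multiplies the character by
  -- `pairing 1 (x i)`, which determines `x i`.
  have hnu' : hammingNorm (Function.update u i ⟨2, hq⟩) = k := hsupp _ fun m => by
    by_cases hmi : m = i
    · simp [hmi, hiT, Fin.ext_iff]
    · by_cases hm : m ∈ T <;> simp [hu, hmi, hm, Fin.ext_iff]
  have h1 := h _ hnu'
  have hui : u i = ⟨1, hq1⟩ := if_pos hiT
  rw [wordChar_update_left, wordChar_update_left, h u hnu, hui] at h1
  have h2 := mul_left_cancel₀ (wordChar_ne_zero u y) h1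
  have h3 : ∀ a : Fin q, pairing ⟨2, hq⟩ a * conj (pairing ⟨1, hq1⟩ a) = pairing ⟨1, hq1⟩ a := by
    intro a
    rw [pairing_one_pow hq1 2, pow_two, mul_assoc, pairing_mul_conj, mul_one]
  rw [h3, h3] at h2
  exact pairing_one_injective hq1 h2

/-- A code whose minimum distance is at least the sum of its dual distance and dual degree is a
binary repetition code. -/
lemma isBinaryRepetitionCode_of_le (hq : 2 ≤ q) {Y : Finset (Fin D → Fin q)} (hY : IsCode Y)
    (h : dualDist Y + dualDegree Y ≤ minDist Y) : IsBinaryRepetitionCode Y := by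
  have : NeZero q := ⟨by omega⟩
  have hmem := Nat.sInf_mem (dualSupport_nonempty hY)
  have hpos : 0 < dualDist Y := Nat.pos_of_ne_zero hmem.1
  have hdeg : 0 < dualDegree Y :=
    (Set.ncard_pos (dualSupport_finite Y)).2 (dualSupport_nonempty hY)
  have hD : minDist Y ≤ D := by
    obtain ⟨x, -, y, -, -, hxy⟩ := exists_hammingDist_eq_minDist hY
    exact hxy ▸ hammingDist_le_card_fintype.trans_eq (Fintype.card_fin D)
  have hsep : ∀ x ∈ Y, ∀ y ∈ Y, ∀ u : Fin D → Fin q, hammingNorm u = dualDist Y →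
      wordChar u x = wordChar u y := fun x hx y hy u hu =>
    wordChar_eq_of_dualDist_add_dualDegree_le hY h hu hx hy
  obtain ⟨x, hx, y, hy, hxy⟩ := Finset.one_lt_card.1 hY.1
  have hne : ∀ z ∈ Y, z ≠ x → ∀ i, z i ≠ x i := fun z hz hzx =>
    -- Here δ* < D, because s* ≥ 1 and δ* + s* ≤ δ ≤ D.
    forall_ne_of_wordChar_eq (by omega) hpos (by omega) hzx (hsep z hz x hx)
  obtain rfl | hq2 := hq.eq_or_lt
  · refine ⟨rfl, x, y, fun i => (hne y hy hxy.symm i).symm, ?_⟩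
    ext z
    simp only [Finset.mem_coe, Set.mem_insert_iff, Set.mem_singleton_iff]
    constructor
    · intro hz
      refine or_iff_not_imp_left.2 fun hzx => funext fun i => ?_
      have h1 := hne z hz hzx i
      have h2 := hne y hy hxy.symm i
      omega
    · rintro (rfl | rfl) <;> assumption
  · exact absurd (eq_of_wordChar_eq hq2 hpos (by omega) (hsep x hx y hy)) hxy

end Repetition

/-! ### Parameters of a bipartite half -/

section BipartiteHalf

variable {D : ℕ}

lemma pairing_one_one : pairing (1 : Fin 2) 1 = -1 := by
  have := (isPrimitiveRoot_exp (q := 2)).eq_neg_one_of_two_right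
  simpa [pairing] using this

lemma wordChar_one_mul (x y : Fin D → Fin 2) :
    wordChar 1 x * wordChar 1 y = (-1) ^ hammingDist x y := by
  have h : ∀ a b : Fin 2, pairing 1 a * pairing 1 b = if a ≠ b then -1 else 1 := by
    intro a b
    have h0 : pairing (1 : Fin 2) 0 = 1 := by simp [pairing]
    fin_cases a <;> fin_cases b <;> simp [h0, pairing_one_one]
  rw [wordChar, wordChar, ← Finset.prod_mul_distrib]
  simp only [Pi.one_apply, h]
  rw [Finset.prod_ite, Finset.prod_const_one, mul_one, Finset.prod_const]
  rfl

lemma neg_one_pow_hammingDist (x y z : Fin D → Fin 2) :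
    (-1 : ℂ) ^ hammingDist y z = (-1) ^ hammingDist x y * (-1) ^ hammingDist x z := by
  have h : wordChar 1 x * wordChar 1 x = 1 := by rw [wordChar_one_mul, hammingDist_self, pow_zero]
  rw [← wordChar_one_mul, ← wordChar_one_mul, ← wordChar_one_mul]
  linear_combination (-(wordChar 1 y * wordChar 1 z)) * h

/-- The all-ones character is the parity sign, so 2χ_Y is the trivial character plus a signed
all-ones character; orthogonality then gives the coefficients. -/
lemma two_mul_fourierCoeff {Y : Finset (Fin D → Fin 2)} {x : Fin D → Fin 2}
    (hx : ∀ y, y ∈ Y ↔ Even (hammingDist x y)) (u : Fin D → Fin 2) :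
    2 * fourierCoeff Y u = (if 0 = u then (2 : ℂ) ^ D else 0) +
      wordChar 1 x * if 1 = u then (2 : ℂ) ^ D else 0 := by
  have h : ∀ v : Fin D → Fin 2,
      ∑ y, wordChar v y * conj (wordChar u y) = if v = u then (2 : ℂ) ^ D else 0 := by
    intro v
    have := sum_wordChar_mul_conj v u
    simp only [wordChar_comm _ v, wordChar_comm _ u] at this
    exact_mod_cast this
  have hs : 2 * fourierCoeff Y u =
      ∑ y, (1 + wordChar 1 x * wordChar 1 y) * conj (wordChar u y) := by
    rw [fourierCoeff, Finset.mul_sum, ← Finset.sum_subset (Finset.subset_univ Y)]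
    · refine Finset.sum_congr rfl fun y hy => ?_
      rw [wordChar_one_mul, ((hx y).1 hy).neg_one_pow]
      norm_num
    · intro y _ hy
      rw [hx, Nat.not_even_iff_odd] at hy
      rw [wordChar_one_mul, hy.neg_one_pow]
      norm_num
  rw [hs, ← h, ← h, Finset.mul_sum, ← Finset.sum_add_distrib]
  refine Finset.sum_congr rfl fun y _ => ?_
  rw [wordChar_zero_left]
  ring

lemma dualSupport_bipartiteHalf (hD : D ≠ 0) {Y : Finset (Fin D → Fin 2)} {x : Fin D → Fin 2}
    (hx : ∀ y, y ∈ Y ↔ Even (hammingDist x y)) : dualSupport Y = {D} := by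
  have hn : hammingNorm (1 : Fin D → Fin 2) = D := by simp [hammingNorm]
  ext j
  rw [mem_dualSupport_iff, Set.mem_singleton_iff]
  constructor
  · rintro ⟨hj, u, rfl, hu⟩
    have h0 : (0 : Fin D → Fin 2) ≠ u := by
      rintro rfl
      exact hj hammingNorm_zero
    by_cases h1 : 1 = u
    · rw [← h1, hn]
    · have := two_mul_fourierCoeff hx u
      rw [if_neg h0, if_neg h1] at this
      exact absurd (by simpa using this) hu
  · rintro rfl
    refine ⟨hD, 1, hn, fun h => ?_⟩
    have h2 := two_mul_fourierCoeff hx 1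
    have h01 : (0 : Fin j → Fin 2) ≠ 1 := fun h01 => hD (by rw [← hn, ← h01, hammingNorm_zero])
    rw [h, if_neg h01, if_pos rfl] at h2
    simp [wordChar_ne_zero] at h2

lemma minDist_bipartiteHalf {Y : Finset (Fin D → Fin 2)} (hY : IsCode Y) {x : Fin D → Fin 2}
    (hx : ∀ y, y ∈ Y ↔ Even (hammingDist x y)) : minDist Y = 2 := by
  obtain ⟨y, hy, z, hz, hyz, hm⟩ := exists_hammingDist_eq_minDist hY
  have heven : Even (hammingDist y z) := by
    have h := neg_one_pow_hammingDist x y z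
    rw [((hx y).1 hy).neg_one_pow, ((hx z).1 hz).neg_one_pow, one_mul] at h
    by_contra ho
    rw [(Nat.not_even_iff_odd.1 ho).neg_one_pow] at h
    norm_num at h
  have hpos : 0 < hammingDist y z := hammingDist_pos.2 hyz
  obtain ⟨k, hk⟩ := heven
  have hD : hammingDist y z ≤ D := hammingDist_le_card_fintype.trans_eq (Fintype.card_fin D)
  -- Distinct codewords are at positive even distance, so D ≥ 2 and flipping two coordinates of `x`
  -- gives a codeword at distance 2.
  obtain ⟨T, -, -, hT⟩ := Finset.exists_subsuperset_card_eq (s := ∅)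
    (t := (univ : Finset (Fin D))) (n := 2) (by simp) (by simp) (by simp; omega)
  have hd : hammingDist x (fun i => if i ∈ T then x i + 1 else x i) = 2 := by
    have hs : ∀ i, x i ≠ (if i ∈ T then x i + 1 else x i) ↔ i ∈ T := by
      intro i
      split_ifs with hi <;> simp [hi]
    simp only [hammingDist, hs]
    simpa using hT
  have hle := minDist_le ((hx x).2 (by simp)) ((hx _).2 (by rw [hd]; exact even_two))
    (hammingDist_ne_zero.1 (by rw [hd]; norm_num))
  omega

end BipartiteHalf

end HammingScheme

theorem mainTheorem8 (D q : ℕ) (hq : 2 ≤ q) (Y : Finset (Fin D → Fin q))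
    (hY : HammingScheme.IsCode Y) :
    (¬ HammingScheme.IsBinaryRepetitionCode Y →
      (HammingScheme.minDist Y : ℤ) ≤
        (HammingScheme.dualDist Y : ℤ) + (HammingScheme.dualDegree Y : ℤ) - 1) ∧
    (HammingScheme.IsBipartiteHalf Y →
      HammingScheme.minDist Y = 2 ∧ HammingScheme.dualDegree Y = 1 ∧
        HammingScheme.dualDist Y = D) := by
  constructor
  · intro h
    by_contra hlt
    exact h (HammingScheme.isBinaryRepetitionCode_of_le hq hY (by omega))
  · rintro ⟨rfl, x, hx⟩
    have hD : D ≠ 0 := by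
      rintro rfl
      exact hY.1.not_ge (Finset.card_le_one_of_subsingleton Y)
    have hS := HammingScheme.dualSupport_bipartiteHalf hD hx
    refine ⟨HammingScheme.minDist_bipartiteHalf hY hx, ?_, ?_⟩
    · rw [HammingScheme.dualDegree, hS, Set.ncard_singleton]
    · rw [HammingScheme.dualDist, hS, csInf_singleton]
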